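/- Let $n$ be a positive integer and let $E_1,\dots,E_n$ and $F$ be Banach spaces over $\mathbb{K}=\mathbb{R}$ or $\mathbb{C}$. For $p\ge 1$ let $\Pi_p^n(E_1,\dots,E_n;F)$ be the set of all multiple $p$-summing maps, i.e. of all continuous $n$-linear maps $A:E_1\times\cdots\times E_n\to F$ for which there is a constant $C\ge 0$ such that $$\Big(\sum_{j_1=1}^{m_1}\cdots\sum_{j_n=1}^{m_n}\big\|A(x^{(1)}_{j_1},\dots,x^{(n)}_{j_n})\big\|^p\Big)^{1/p}\le C\prod_{k=1}^n\ \sup_{\varphi\in E_k',\,\|\varphi\|\le 1}\Big(\sum_{j=1}^{m_k}|\varphi(x^{(k)}_j)|^p\Big)^{1/p}$$ for all $m_1,\dots,m_n\in\mathbb{N}$ and all $x^{(k)}_j\in E_k$ ($1\le j\le m_k$, $1\le k\le n$). A Banach space $E$ has cotype $2$ if there is a constant $C\ge 0$ such that $$\Big(\sum_{i=1}^m\|x_i\|^2\Big)^{1/2}\le C\Big(2^{-m}\sum_{\varepsilon\in\{-1,1\}^m}\Big\|\sum_{i=1}^m\varepsilon_i x_i\Big\|^2\Big)^{1/2}$$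 for all $m\in\mathbb{N}$ and $x_1,\dots,x_m\in E$. If $E_1,\dots,E_n$ have cotype $2$, then $$\Pi_2^n(E_1,\dots,E_n;F)\subset\Pi_p^n(E_1,\dots,E_n;F)\quad\text{for every }1\le p\le 2,$$ and $$\Pi_p^n(E_1,\dots,E_n;F)=\Pi_r^n(E_1,\dots,E_n;F)\quad\text{for every }1\le p\le r<2.$$ -/

import Mathlib

namespace MultipleSumming

/-- The weak `ℓ_p`-norm of a finite family `x` in `E`: the supremum of
`(∑ j, |φ (x j)| ^ p) ^ (1 / p)` over the functionals `φ` in the closed unit ball of the dual. -/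
noncomputable def weakNorm (𝕜 : Type*) [RCLike 𝕜] {E : Type*} [NormedAddCommGroup E]
    [NormedSpace 𝕜 E] {m : ℕ} (p : ℝ) (x : Fin m → E) : ℝ :=
  ⨆ φ : {φ : StrongDual 𝕜 E // ‖φ‖ ≤ 1}, (∑ j, ‖(φ : StrongDual 𝕜 E) (x j)‖ ^ p) ^ (1 / p)

/-- The supremum in `weakNorm` is over a bounded set, hence a genuine supremum. -/
theorem bddAbove_weakNorm (𝕜 : Type*) [RCLike 𝕜] {E : Type*} [NormedAddCommGroup E]
    [NormedSpace 𝕜 E] {m : ℕ} {p : ℝ} (hp : 1 ≤ p) (x : Fin m → E) :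
    BddAbove (Set.range fun φ : {φ : StrongDual 𝕜 E // ‖φ‖ ≤ 1} =>
      (∑ j, ‖(φ : StrongDual 𝕜 E) (x j)‖ ^ p) ^ (1 / p)) := by
  refine ⟨(∑ j, ‖x j‖ ^ p) ^ (1 / p), ?_⟩
  rintro _ ⟨φ, rfl⟩
  have h : ∀ j, ‖(φ : StrongDual 𝕜 E) (x j)‖ ≤ ‖x j‖ := fun j => by
    simpa using (φ : StrongDual 𝕜 E).le_of_opNorm_le φ.2 (x j)
  have hs : (∑ j, ‖(φ : StrongDual 𝕜 E) (x j)‖ ^ p) ≤ ∑ j, ‖x j‖ ^ p :=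
    Finset.sum_le_sum fun j _ => Real.rpow_le_rpow (norm_nonneg _) (h j) (by linarith)
  exact Real.rpow_le_rpow (Finset.sum_nonneg fun j _ => by positivity) hs (by positivity)

/-- A continuous `n`-linear map `A` is multiple `(q; p₁, …, pₙ)`-summing
(considered for `1 ≤ p k ≤ q`). -/
def IsMultipleSumming {𝕜 : Type*} [RCLike 𝕜] {n : ℕ} {E : Fin n → Type*}
    [∀ k, NormedAddCommGroup (E k)] [∀ k, NormedSpace 𝕜 (E k)]
    {F : Type*} [NormedAddCommGroup F] [NormedSpace 𝕜 F]
    (q : ℝ) (p : Fin n → ℝ) (A : ContinuousMultilinearMap 𝕜 E F) : Prop :=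
  ∃ C : ℝ, 0 ≤ C ∧ ∀ (m : Fin n → ℕ) (x : ∀ k, Fin (m k) → E k),
    (∑ j : (∀ k, Fin (m k)), ‖A (fun k => x k (j k))‖ ^ q) ^ (1 / q)
      ≤ C * ∏ k, weakNorm 𝕜 (p k) (x k)

/-- `Π_p^n(E₁, …, Eₙ; F)`: the multiple `(p; p, …, p)`-summing maps among the continuous
`n`-linear maps `E₁ × ⋯ × Eₙ → F`. -/
def multipleSumming (𝕜 : Type*) [RCLike 𝕜] {n : ℕ} (E : Fin n → Type*)
    [∀ k, NormedAddCommGroup (E k)] [∀ k, NormedSpace 𝕜 (E k)]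
    (F : Type*) [NormedAddCommGroup F] [NormedSpace 𝕜 F] (p : ℝ) :
    Set (ContinuousMultilinearMap 𝕜 E F) :=
  {A | IsMultipleSumming p (fun _ => p) A}

/-- `E` has (Rademacher) cotype `q` (considered for `2 ≤ q < ∞`): for some constant `C`,
`(∑ ‖x i‖ ^ q) ^ (1 / q) ≤ C * (𝔼 ‖∑ ε i • x i‖ ^ 2) ^ (1 / 2)` for all finite families `x`,
where `𝔼` is the average over all `2 ^ m` choices of signs `ε`. -/
def HasCotype (q : ℝ) (E : Type*) [NormedAddCommGroup E] : Prop :=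
  ∃ C : ℝ, 0 ≤ C ∧ ∀ (m : ℕ) (x : Fin m → E),
    (∑ i, ‖x i‖ ^ q) ^ (1 / q)
      ≤ C * ((∑ ε : Fin m → ℤˣ, ‖∑ i, (ε i : ℤ) • x i‖ ^ 2) / 2 ^ m) ^ (1 / 2 : ℝ)

end MultipleSumming

namespace MultipleSumming

/-! ### Weak norms and operators on finite-dimensional `ℓ_∞` -/

section WeakNorm

variable {𝕜 : Type*} [RCLike 𝕜] {E : Type*} [NormedAddCommGroup E] [NormedSpace 𝕜 E] {m : ℕ}

/-! Every class is compared with the one for `p = 1`.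

Under cotype `2`, `Π_r ⊆ Π_1` for `1 ≤ r ≤ 2` (`multipleSumming_subset_one`). A family `x` in `E k`
is an operator from `ℓ_∞^m` sending unit vectors to the `x j`, with norm at most the weak `1`-norm.
By Maurey's theorem cotype `2` makes it `2`-summing, and Pietsch domination yields `x j = μ j • t j`
with weights of total mass at most `1` and `t` weakly bounded in `L_2(μ)`
(`HasCotype.exists_weights`). The family `μ j ^ (1 / r) • t j` is then controlled in weak `ℓ_r`, and
Jensen's inequality for the product weights passes from the `r`-sum to the `1`-sum.

Conversely `Π_1 ⊆ Π_r` for `1 ≤ r < 2` without any cotype (`multipleSumming_one_subset`). Signed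
heavy-tailed coefficients embed `ℓ_r^m` into some `ℓ_1^N` with uniform constants, and the lower
estimate holds for vectors of any normed space (`exists_randomization`). Replacing each family by
its random combinations turns weak `ℓ_r` data into weak `ℓ_1` data, and the lower estimate, iterated
over the `n` variables, recovers the `r`-sum. -/

theorem weakNorm_nonneg (p : ℝ) (x : Fin m → E) : 0 ≤ weakNorm 𝕜 p x :=
  Real.iSup_nonneg fun _ => by positivity

theorem le_weakNorm {p : ℝ} (hp : 1 ≤ p) (x : Fin m → E) (φ : StrongDual 𝕜 E) (hφ : ‖φ‖ ≤ 1) :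
    (∑ j, ‖φ (x j)‖ ^ p) ^ (1 / p) ≤ weakNorm 𝕜 p x :=
  le_ciSup (bddAbove_weakNorm 𝕜 hp x) ⟨φ, hφ⟩

theorem weakNorm_le {p B : ℝ} (hB : 0 ≤ B) (x : Fin m → E)
    (h : ∀ φ : StrongDual 𝕜 E, ‖φ‖ ≤ 1 → (∑ j, ‖φ (x j)‖ ^ p) ^ (1 / p) ≤ B) :
    weakNorm 𝕜 p x ≤ B :=
  Real.iSup_le (fun φ => h φ.1 φ.2) hB

theorem sum_norm_le_weakNorm_one (x : Fin m → E) (φ : StrongDual 𝕜 E) (hφ : ‖φ‖ ≤ 1) :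
    ∑ j, ‖φ (x j)‖ ≤ weakNorm 𝕜 1 x := by
  simpa using le_weakNorm le_rfl x φ hφ

/-- Bounds the norm of the operator from `ℓ_∞^m` attached to `x`; a norming functional reduces it to
scalars. -/
theorem norm_sum_smul_le_weakNorm_one (x : Fin m → E) (a : Fin m → 𝕜) {t : ℝ}
    (ha : ∀ j, ‖a j‖ ≤ t) (ht : 0 ≤ t) : ‖∑ j, a j • x j‖ ≤ t * weakNorm 𝕜 1 x := by
  obtain ⟨φ, hφ, h⟩ := exists_dual_vector'' 𝕜 (∑ j, a j • x j)
  have h1 : ‖∑ j, a j • x j‖ = ‖φ (∑ j, a j • x j)‖ := by rw [h]; simp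
  rw [h1, map_sum]
  calc ‖∑ j, φ (a j • x j)‖ ≤ ∑ j, ‖φ (a j • x j)‖ := norm_sum_le _ _
    _ ≤ ∑ j, t * ‖φ (x j)‖ := Finset.sum_le_sum fun j _ => by
        rw [map_smul, norm_smul]
        exact mul_le_mul_of_nonneg_right (ha j) (norm_nonneg _)
    _ = t * ∑ j, ‖φ (x j)‖ := by rw [Finset.mul_sum]
    _ ≤ _ := mul_le_mul_of_nonneg_left (sum_norm_le_weakNorm_one x φ hφ) ht

end WeakNorm

/-! ### Khintchine-type estimates for random signs -/

section Signs

/-- Conditioning on all signs but the first; this drives the inductions on `m` below. -/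
theorem sum_signs_succ {V : Type*} [AddCommGroup V] {m : ℕ} (G : V → ℝ) (v : Fin (m + 1) → V) :
    ∑ ε : Fin (m + 1) → ℤˣ, G (∑ i, (ε i : ℤ) • v i) =
      ∑ ε : Fin m → ℤˣ, (G (∑ i, (ε i : ℤ) • v i.succ + v 0) +
        G (∑ i, (ε i : ℤ) • v i.succ - v 0)) := by
  rw [← (Fin.consEquiv fun _ => ℤˣ).sum_comp, Fintype.sum_prod_type, Finset.sum_add_distrib]
  have h : (Finset.univ : Finset ℤˣ) = {1, -1} := rfl
  rw [h, Finset.sum_pair (by decide)]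
  simp [Fin.consEquiv, Fin.sum_univ_succ, add_comm, sub_eq_add_neg]

variable {𝕜 : Type*} [RCLike 𝕜]

theorem sum_signs_norm_sq {m : ℕ} (b : Fin m → 𝕜) :
    ∑ ε : Fin m → ℤˣ, ‖∑ i, (ε i : ℤ) • b i‖ ^ 2 = 2 ^ m * ∑ i, ‖b i‖ ^ 2 := by
  induction m with
  | zero => simp
  | succ m ih =>
    rw [sum_signs_succ (fun z => ‖z‖ ^ 2) b]
    have h : ∀ s : 𝕜, ‖s + b 0‖ ^ 2 + ‖s - b 0‖ ^ 2 = 2 * ‖s‖ ^ 2 + 2 * ‖b 0‖ ^ 2 := fun s => by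
      have := parallelogram_law_with_norm 𝕜 s (b 0); linarith
    simp only [h]
    rw [Finset.sum_add_distrib, ← Finset.mul_sum, ih, Fin.sum_univ_succ]
    simp
    ring

theorem norm_add_pow_four_add_norm_sub_pow_four_le (s b : 𝕜) :
    ‖s + b‖ ^ 4 + ‖s - b‖ ^ 4 ≤ 2 * ‖s‖ ^ 4 + 12 * ‖b‖ ^ 2 * ‖s‖ ^ 2 + 2 * ‖b‖ ^ 4 := by
  have h1 := @norm_add_sq 𝕜 𝕜 _ _ _ s b
  have h2 := @norm_sub_sq 𝕜 𝕜 _ _ _ s b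
  have h3 : |RCLike.re (inner 𝕜 s b)| ≤ ‖s‖ * ‖b‖ :=
    (RCLike.abs_re_le_norm _).trans (norm_inner_le_norm s b)
  have h4 := sq_le_sq' (abs_le.1 h3).1 (abs_le.1 h3).2
  have e1 : ‖s + b‖ ^ 4 = (‖s + b‖ ^ 2) ^ 2 := by ring
  have e2 : ‖s - b‖ ^ 4 = (‖s - b‖ ^ 2) ^ 2 := by ring
  rw [e1, e2, h1, h2]
  nlinarith

/-- With `S` the sum of squares of the tail and `β = ‖b 0‖`, the induction closes because `3 (S +
β²)² = 3S² + 6Sβ² + 3β⁴` dominates the one-step bound `3S² + 6Sβ² + β⁴`. -/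
theorem sum_signs_norm_pow_four_le {m : ℕ} (b : Fin m → 𝕜) :
    ∑ ε : Fin m → ℤˣ, ‖∑ i, (ε i : ℤ) • b i‖ ^ 4 ≤ 3 * 2 ^ m * (∑ i, ‖b i‖ ^ 2) ^ 2 := by
  induction m with
  | zero => simp
  | succ m ih =>
    rw [sum_signs_succ (fun z => ‖z‖ ^ 4) b]
    refine (Finset.sum_le_sum fun ε _ =>
      norm_add_pow_four_add_norm_sub_pow_four_le _ (b 0)).trans ?_
    rw [Finset.sum_add_distrib, Finset.sum_add_distrib, ← Finset.mul_sum, ← Finset.mul_sum,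
      sum_signs_norm_sq, Fin.sum_univ_succ]
    have := ih fun i => b i.succ
    have h2 : (0 : ℝ) ≤ 2 ^ m * ‖b 0‖ ^ 4 := by positivity
    simp only [Finset.sum_const, Finset.card_univ, Fintype.card_pi, Fintype.card_units_int,
      Finset.prod_const, Fintype.card_fin, nsmul_eq_mul, Nat.cast_pow, Nat.cast_ofNat, pow_succ] at *
    nlinarith

theorem sum_signs_norm_le {m : ℕ} (b : Fin m → 𝕜) :
    ∑ ε : Fin m → ℤˣ, ‖∑ i, (ε i : ℤ) • b i‖ ≤ 2 ^ m * √(∑ i, ‖b i‖ ^ 2) := by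
  have h := sq_sum_le_card_mul_sum_sq (s := (Finset.univ : Finset (Fin m → ℤˣ)))
    (f := fun ε => ‖∑ i, (ε i : ℤ) • b i‖)
  rw [sum_signs_norm_sq] at h
  refine le_of_sq_le_sq ?_ (by positivity)
  rw [mul_pow, Real.sq_sqrt (by positivity)]
  have hc : ((Finset.univ : Finset (Fin m → ℤˣ)).card : ℝ) = 2 ^ m := by simp
  rw [hc] at h
  linarith

variable (𝕜) in
-- Flipping the `j`-th sign pairs signed sums that differ by `±2 v j`.
theorem norm_le_sum_signs {V : Type*} [NormedAddCommGroup V] [NormedSpace 𝕜 V] {m : ℕ} (v : Fin m → V)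
    (j : Fin m) : 2 ^ m * ‖v j‖ ≤ ∑ ε : Fin m → ℤˣ, ‖∑ i, (ε i : ℤ) • v i‖ := by
  let flip : Equiv.Perm (Fin m → ℤˣ) :=
    ⟨fun ε i => if i = j then -ε i else ε i, fun ε i => if i = j then -ε i else ε i,
      fun ε => by ext i; by_cases h : i = j <;> simp [h],
      fun ε => by ext i; by_cases h : i = j <;> simp [h]⟩
  have h1 := Equiv.sum_comp flip fun ε : Fin m → ℤˣ => ‖∑ i, (ε i : ℤ) • v i‖
  have h2 : ∀ ε : Fin m → ℤˣ, 2 * ‖v j‖ ≤ ‖∑ i, (ε i : ℤ) • v i‖ +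
      ‖∑ i, (flip ε i : ℤ) • v i‖ := fun ε => by
    have h3 : ∑ i, (ε i : ℤ) • v i - ∑ i, (flip ε i : ℤ) • v i
        = (ε j : ℤ) • v j + (ε j : ℤ) • v j := by
      rw [← Finset.sum_sub_distrib, Finset.sum_eq_single j]
      · simp [flip]
      · intro i _ hi; simp [flip, hi]
      · simp
    refine le_trans ?_ (norm_sub_le _ _)
    rw [h3]
    rw [← two_smul 𝕜, norm_smul, RCLike.norm_two]
    rcases Int.units_eq_one_or (ε j) with h | h <;> simp [h]
  have h4 := Finset.sum_le_sum fun ε (_ : ε ∈ Finset.univ) => h2 ε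
  rw [Finset.sum_add_distrib, h1] at h4
  simp at h4
  linarith

end Signs


/-! ### Maurey's theorem: cotype `2` yields Pietsch domination on `ℓ_∞^m` -/

section Domination

variable {𝕜 : Type*} [RCLike 𝕜] {E : Type*} [NormedAddCommGroup E] [NormedSpace 𝕜 E] {m : ℕ}

/-- Pietsch domination for operators on a finite-dimensional `ℓ_∞`-space, in the case of
`2`-summing operators. -/
theorem exists_weights_of_square_function_bound (u : (Fin m → 𝕜) →ₗ[𝕜] E) {κ : ℝ} (hκ : 0 ≤ κ)
    (h : ∀ (N : ℕ) (f : Fin N → Fin m → 𝕜) (s : ℝ), 0 < s →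
      (∀ j, ∑ i, ‖f i j‖ ^ 2 ≤ s) → ∑ i, ‖u (f i)‖ ^ 2 ≤ κ * s) :
    ∃ μ : Fin m → ℝ, (∀ j, 0 ≤ μ j) ∧ ∑ j, μ j ≤ 1 ∧
      ∀ a : Fin m → 𝕜, ‖u a‖ ^ 2 ≤ κ * ∑ j, μ j * ‖a j‖ ^ 2 := by
  rcases Nat.eq_zero_or_pos m with rfl | hm
  · refine ⟨0, by simp, by simp, fun a => ?_⟩
    have : a = 0 := Subsingleton.elim _ _
    rw [this, map_zero]
    simp
  have : Nonempty (Fin m) := ⟨⟨0, hm⟩⟩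
  -- The hypothesis says that no element of this convex cone is negative everywhere. Separating it
  -- from the open negative orthant gives a positive functional, which is `μ` after normalization.
  let S : Set (Fin m → ℝ) := {v | ∃ (N : ℕ) (f : Fin N → Fin m → 𝕜),
    v = fun j => κ * ∑ i, ‖f i j‖ ^ 2 - ∑ i, ‖u (f i)‖ ^ 2}
  let O : Set (Fin m → ℝ) := {v | ∀ j, v j < 0}
  have hO : IsOpen O := by
    have : O = ⋂ j, {v | v j < 0} := by ext; simp [O]
    rw [this]
    exact isOpen_iInter_of_finite fun j => isOpen_lt (continuous_apply j) continuous_const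
  have hOc : Convex ℝ O := by
    have : O = ⋂ j, {v | v j < 0} := by ext; simp [O]
    rw [this]
    exact convex_iInter fun j => convex_halfSpace_lt (LinearMap.proj (R := ℝ) j).isLinear 0
  have hadd : ∀ v ∈ S, ∀ w ∈ S, v + w ∈ S := by
    rintro _ ⟨N, f, rfl⟩ _ ⟨M, g, rfl⟩
    refine ⟨N + M, Fin.append f g, ?_⟩
    ext j
    simp only [Pi.add_apply, Fin.sum_univ_add, Fin.append_left, Fin.append_right]
    ring
  have hsmul : ∀ v ∈ S, ∀ t : ℝ, 0 ≤ t → t • v ∈ S := by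
    rintro _ ⟨N, f, rfl⟩ t ht
    refine ⟨N, fun i => ((√t : ℝ) : 𝕜) • f i, ?_⟩
    ext j
    simp only [map_smul, norm_smul, norm_mul, Pi.smul_apply, mul_pow, RCLike.norm_ofReal, sq_abs,
      Real.sq_sqrt ht, smul_eq_mul, ← Finset.mul_sum]
    ring
  have hSc : Convex ℝ S := fun v hv w hw a b ha hb _ =>
    hadd _ (hsmul v hv a ha) _ (hsmul w hw b hb)
  have hdisj : Disjoint O S := by
    rw [Set.disjoint_left]
    rintro _ hv ⟨N, f, rfl⟩
    obtain ⟨j₀, hj₀⟩ := Finite.exists_max fun j => ∑ i, ‖f i j‖ ^ 2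
    have h1 : ∑ i, ‖u (f i)‖ ^ 2 ≤ κ * ∑ i, ‖f i j₀‖ ^ 2 := by
      -- The maximum may be zero while `h` needs `s > 0`, hence the slack `δ / (κ + 1)`.
      refine le_of_forall_pos_le_add fun δ hδ => ?_
      have hs : 0 < ∑ i, ‖f i j₀‖ ^ 2 + δ / (κ + 1) := by positivity
      refine (h N f _ hs fun j => (hj₀ j).trans (by simp; positivity)).trans ?_
      rw [mul_add]
      gcongr
      rw [mul_div_assoc', div_le_iff₀ (by positivity)]
      nlinarith
    have h2 := hv j₀
    simp only at h2
    linarith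
  obtain ⟨l, c, hl1, hl2⟩ := geometric_hahn_banach_open hOc hO hSc hdisj
  have hc0 : c ≤ 0 := by
    have := hl2 0 ⟨0, Fin.elim0, by ext; simp⟩
    simpa using this
  have hlS : ∀ v ∈ S, 0 ≤ l v := by
    intro v hv
    by_contra! hneg
    -- A large multiple of `v` stays in the cone but would fall below the separating level `c`.
    have h0 : l ((c / l v + 1) • v) = c + l v := by
      rw [map_smul, smul_eq_mul, add_mul, div_mul_cancel₀ _ hneg.ne, one_mul]
    have := hl2 _ (hsmul v hv (c / l v + 1)
      (add_nonneg (div_nonneg_of_nonpos hc0 hneg.le) zero_le_one))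
    linarith
  have hlO : ∀ v ∈ O, l v < 0 := fun v hv => (hl1 v hv).trans_le hc0
  have hrep : ∀ v : Fin m → ℝ, l v = ∑ j, l (Pi.single j 1) * v j := by
    intro v
    conv_lhs => rw [← Finset.univ_sum_single v]
    rw [map_sum]
    refine Finset.sum_congr rfl fun j _ => ?_
    have : Pi.single j (v j) = v j • (Pi.single j 1 : Fin m → ℝ) := by
      rw [← Pi.single_smul]; simp
    rw [this, map_smul, smul_eq_mul, mul_comm]
  set w : Fin m → ℝ := fun j => l (Pi.single j 1) with hw
  have hone : l (fun _ => -1) < 0 := hlO _ fun _ => by norm_num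
  have hwsum : 0 < ∑ j, w j := by
    rw [hrep] at hone
    simpa using hone
  have hwpos : ∀ j, 0 ≤ w j := by
    intro j
    by_contra! hneg
    -- The constant is chosen so that `l` vanishes on this vector, although the vector is negative
    -- everywhere.
    have h1 : l (fun i => -(Pi.single j (1 : ℝ) : Fin m → ℝ) i - (-w j / ∑ i, w i)) < 0 :=
      hlO _ fun i => by
        have : 0 < -w j / ∑ i, w i := div_pos (by linarith) hwsum
        have h2 : 0 ≤ (Pi.single j (1 : ℝ) : Fin m → ℝ) i := by
          by_cases hij : i = j
          · subst hij; simp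
          · simp [hij]
        linarith
    rw [hrep] at h1
    simp only [mul_sub, Finset.sum_sub_distrib, mul_neg, Finset.sum_neg_distrib] at h1
    rw [← Finset.sum_mul, mul_div_cancel₀ _ hwsum.ne'] at h1
    simp [Pi.single_apply] at h1
    simp only [hw] at hneg
    linarith
  refine ⟨fun j => w j / ∑ i, w i, fun j => div_nonneg (hwpos j) hwsum.le, ?_, fun a => ?_⟩
  · rw [← Finset.sum_div, div_self hwsum.ne']
  · have h1 := hlS _ ⟨1, fun _ => a, rfl⟩
    rw [hrep] at h1
    simp only [Finset.univ_unique, Finset.sum_const, Finset.card_singleton, one_smul, mul_sub,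
      Finset.sum_sub_distrib] at h1
    change 0 ≤ ∑ j, w j * (κ * ‖a j‖ ^ 2) - ∑ j, w j * ‖u a‖ ^ 2 at h1
    rw [← Finset.sum_mul, sub_nonneg] at h1
    have h2 : κ * ∑ j, w j / (∑ i, w i) * ‖a j‖ ^ 2
        = (∑ j, w j * (κ * ‖a j‖ ^ 2)) / ∑ i, w i := by
      rw [Finset.mul_sum, Finset.sum_div]
      exact Finset.sum_congr rfl fun j _ => by ring
    rw [h2, le_div_iff₀ hwsum]
    linarith

/-- One step of the bootstrap: truncation and the fourth moment Khintchine inequality halve the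
constant in a Pietsch domination, up to an additive constant. -/
theorem square_function_bound_of_domination {C D B κ : ℝ} (hD : 0 < D) (hCD : C ^ 2 ≤ D)
    (hκ : 0 ≤ κ)
    (hC : ∀ (N : ℕ) (x : Fin N → E), ∑ i, ‖x i‖ ^ 2 ≤
      C ^ 2 * ((∑ ε : Fin N → ℤˣ, ‖∑ i, (ε i : ℤ) • x i‖ ^ 2) / 2 ^ N))
    (u : (Fin m → 𝕜) →ₗ[𝕜] E)
    (hu : ∀ (a : Fin m → 𝕜) (t : ℝ), 0 ≤ t → (∀ j, ‖a j‖ ≤ t) → ‖u a‖ ≤ t * B)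
    {μ : Fin m → ℝ} (hμ : ∀ j, 0 ≤ μ j) (hμ1 : ∑ j, μ j ≤ 1)
    (hdom : ∀ a : Fin m → 𝕜, ‖u a‖ ^ 2 ≤ κ * ∑ j, μ j * ‖a j‖ ^ 2)
    {N : ℕ} (f : Fin N → Fin m → 𝕜) {s : ℝ} (hs : 0 < s)
    (hf : ∀ j, ∑ i, ‖f i j‖ ^ 2 ≤ s) :
    ∑ i, ‖u (f i)‖ ^ 2 ≤ (24 * D ^ 2 * B ^ 2 + κ / 2) * s := by
  have hsplit : ∀ g : Fin m → 𝕜, ‖u g‖ ^ 2 ≤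
      24 * D * s * B ^ 2 + κ / (6 * D * s) * ∑ j, μ j * ‖g j‖ ^ 4 := by
    intro g
    -- Below level `T` the sup-norm bound applies; above it `‖g‖² ≤ ‖g‖⁴ / T²`. The 12 makes the
    -- factor on `κ` equal to `D · 2 · 3 / (12 D) = 1/2`, where 2 comes from splitting the square
    -- and 3 from the fourth moment.
    set T := √(12 * D * s) with hT
    have hT2 : T ^ 2 = 12 * D * s := Real.sq_sqrt (by positivity)
    have hT0 : 0 ≤ T := Real.sqrt_nonneg _
    let g₁ : Fin m → 𝕜 := fun j => if ‖g j‖ ≤ T then g j else 0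
    let g₂ : Fin m → 𝕜 := fun j => if ‖g j‖ ≤ T then 0 else g j
    have hg : g = g₁ + g₂ := by
      ext j
      by_cases hj : ‖g j‖ ≤ T <;> simp [g₁, g₂, hj]
    have h1 : ‖u g₁‖ ≤ T * B := hu _ _ hT0 fun j => by
      by_cases hj : ‖g j‖ ≤ T <;> simp [g₁, hj, hT0]
    have h1' : ‖u g₁‖ ^ 2 ≤ 12 * D * s * B ^ 2 := by
      rw [← hT2, ← mul_pow]
      exact pow_le_pow_left₀ (norm_nonneg _) h1 2
    have h2 : ‖u g₂‖ ^ 2 ≤ κ / (12 * D * s) * ∑ j, μ j * ‖g j‖ ^ 4 := by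
      refine (hdom g₂).trans ?_
      rw [div_mul_eq_mul_div, mul_div_assoc, Finset.sum_div]
      gcongr with j _
      rw [mul_div_assoc]
      refine mul_le_mul_of_nonneg_left ?_ (hμ j)
      rw [le_div_iff₀ (by positivity), ← hT2]
      by_cases hj : ‖g j‖ ≤ T
      · simp [g₂, hj]
      · simp only [g₂, hj, if_false]
        have : T ^ 2 ≤ ‖g j‖ ^ 2 := pow_le_pow_left₀ hT0 (not_le.1 hj).le 2
        nlinarith [sq_nonneg ‖g j‖]
    have h3 : ‖u g‖ ≤ ‖u g₁‖ + ‖u g₂‖ := by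
      conv_lhs => rw [hg, map_add]
      exact norm_add_le _ _
    have h4 : ‖u g‖ ^ 2 ≤ 2 * ‖u g₁‖ ^ 2 + 2 * ‖u g₂‖ ^ 2 := by
      nlinarith [norm_nonneg (u g), sq_nonneg (‖u g₁‖ - ‖u g₂‖)]
    have h5 : κ / (6 * D * s) = 2 * (κ / (12 * D * s)) := by
      field_simp
      ring
    rw [h5]
    linarith
  have hmom : ∑ ε : Fin N → ℤˣ, ‖∑ i, (ε i : ℤ) • u (f i)‖ ^ 2 ≤
      2 ^ N * ((24 * D * B ^ 2 + κ / (2 * D)) * s) := by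
    have h1 : ∀ ε : Fin N → ℤˣ, ‖∑ i, (ε i : ℤ) • u (f i)‖ ^ 2 ≤ 24 * D * s * B ^ 2 +
        κ / (6 * D * s) * ∑ j, μ j * ‖∑ i, (ε i : ℤ) • f i j‖ ^ 4 := fun ε => by
      have := hsplit (∑ i, (ε i : ℤ) • f i)
      simpa only [map_sum, map_zsmul, Finset.sum_apply, Pi.smul_apply] using this
    refine (Finset.sum_le_sum fun ε _ => h1 ε).trans ?_
    have hc : ((Finset.univ : Finset (Fin N → ℤˣ)).card : ℝ) = 2 ^ N := by simp
    rw [Finset.sum_add_distrib, Finset.sum_const, nsmul_eq_mul, hc, ← Finset.mul_sum,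
      Finset.sum_comm]
    have h2 : ∑ j, ∑ ε : Fin N → ℤˣ, μ j * ‖∑ i, (ε i : ℤ) • f i j‖ ^ 4 ≤
        3 * 2 ^ N * s ^ 2 := by
      calc _ ≤ ∑ j, μ j * (3 * 2 ^ N * s ^ 2) := by
            refine Finset.sum_le_sum fun j _ => ?_
            rw [← Finset.mul_sum]
            refine mul_le_mul_of_nonneg_left ?_ (hμ j)
            refine (sum_signs_norm_pow_four_le _).trans ?_
            have := hf j
            gcongr
        _ = (∑ j, μ j) * (3 * 2 ^ N * s ^ 2) := by rw [Finset.sum_mul]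
        _ ≤ _ := mul_le_of_le_one_left (by positivity) hμ1
    have h3 : κ / (6 * D * s) * (∑ j, ∑ ε : Fin N → ℤˣ, μ j * ‖∑ i, (ε i : ℤ) • f i j‖ ^ 4) ≤
        κ / (6 * D * s) * (3 * 2 ^ N * s ^ 2) := by gcongr
    refine (add_le_add_right h3 _).trans (le_of_eq ?_)
    field_simp
    ring
  refine (hC N fun i => u (f i)).trans ?_
  have h6 : (∑ ε : Fin N → ℤˣ, ‖∑ i, (ε i : ℤ) • u (f i)‖ ^ 2) / 2 ^ N ≤
      (24 * D * B ^ 2 + κ / (2 * D)) * s := by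
    rw [div_le_iff₀' (by positivity)]
    exact hmom
  refine (mul_le_mul hCD h6 (by positivity) hD.le).trans (le_of_eq ?_)
  field_simp

/-- In a space of cotype `2`, operators on `ℓ_∞` are dominated by an `L_2`-norm. -/
theorem exists_domination_of_cotype {C D B : ℝ} (hD : 0 < D) (hCD : C ^ 2 ≤ D) (hB : 0 < B)
    (hC : ∀ (N : ℕ) (x : Fin N → E), ∑ i, ‖x i‖ ^ 2 ≤
      C ^ 2 * ((∑ ε : Fin N → ℤˣ, ‖∑ i, (ε i : ℤ) • x i‖ ^ 2) / 2 ^ N))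
    (u : (Fin m → 𝕜) →ₗ[𝕜] E)
    (hu : ∀ (a : Fin m → 𝕜) (t : ℝ), 0 ≤ t → (∀ j, ‖a j‖ ≤ t) → ‖u a‖ ≤ t * B) :
    ∃ μ : Fin m → ℝ, (∀ j, 0 ≤ μ j) ∧ ∑ j, μ j ≤ 1 ∧
      ∀ a : Fin m → 𝕜, ‖u a‖ ^ 2 ≤ 49 * D ^ 2 * B ^ 2 * ∑ j, μ j * ‖a j‖ ^ 2 := by
  obtain ⟨κ₀, hκ₀, hbase⟩ : ∃ κ : ℝ, 0 ≤ κ ∧ ∃ μ : Fin m → ℝ, (∀ j, 0 ≤ μ j) ∧ ∑ j, μ j ≤ 1 ∧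
      ∀ a : Fin m → 𝕜, ‖u a‖ ^ 2 ≤ κ * ∑ j, μ j * ‖a j‖ ^ 2 := by
    -- A crude start: uniform weights, with a constant depending on `m` that the iteration removes.
    refine ⟨m * B ^ 2, by positivity, fun _ => (m : ℝ)⁻¹, fun _ => by positivity, ?_, fun a => ?_⟩
    · simpa using mul_inv_le_one
    · have h1 := hu a (√(∑ j, ‖a j‖ ^ 2)) (Real.sqrt_nonneg _) fun j => by
        refine Real.le_sqrt_of_sq_le ?_
        exact Finset.single_le_sum (f := fun j => ‖a j‖ ^ 2) (fun _ _ => by positivity)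
          (Finset.mem_univ j)
      have h2 := pow_le_pow_left₀ (norm_nonneg _) h1 2
      rw [mul_pow, Real.sq_sqrt (by positivity)] at h2
      rcases Nat.eq_zero_or_pos m with rfl | hm
      · simpa using h2
      · refine h2.trans (le_of_eq ?_)
        rw [← Finset.mul_sum]
        field_simp
  -- The recursion `κ ↦ 24 D² B² + κ / 2` has fixed point `48 D² B²`, approached geometrically.
  have hiter : ∀ k : ℕ, ∃ μ : Fin m → ℝ, (∀ j, 0 ≤ μ j) ∧ ∑ j, μ j ≤ 1 ∧
      ∀ a : Fin m → 𝕜, ‖u a‖ ^ 2 ≤ (48 * D ^ 2 * B ^ 2 + κ₀ * (1 / 2) ^ k) *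
        ∑ j, μ j * ‖a j‖ ^ 2 := by
    intro k
    induction k with
    | zero =>
      obtain ⟨μ, h1, h2, h3⟩ := hbase
      refine ⟨μ, h1, h2, fun a => (h3 a).trans ?_⟩
      have : 0 ≤ ∑ j, μ j * ‖a j‖ ^ 2 :=
        Finset.sum_nonneg fun j _ => mul_nonneg (h1 j) (by positivity)
      refine mul_le_mul_of_nonneg_right ?_ this
      simp
      positivity
    | succ k ih =>
      obtain ⟨μ, h1, h2, h3⟩ := ih
      have := exists_weights_of_square_function_bound u (κ := 24 * D ^ 2 * B ^ 2 +
        (48 * D ^ 2 * B ^ 2 + κ₀ * (1 / 2) ^ k) / 2) (by positivity) fun N f s hs hf =>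
          square_function_bound_of_domination hD hCD (by positivity) hC u hu h1 h2 h3 f hs hf
      convert this using 7
      ring
  obtain ⟨k, hk⟩ : ∃ k : ℕ, κ₀ * (1 / 2) ^ k < D ^ 2 * B ^ 2 := by
    have h := (tendsto_pow_atTop_nhds_zero_of_lt_one (r := (1 / 2 : ℝ)) (by norm_num)
      (by norm_num)).const_mul κ₀
    rw [mul_zero] at h
    exact (h.eventually (gt_mem_nhds (by positivity : 0 < D ^ 2 * B ^ 2))).exists
  obtain ⟨μ, h1, h2, h3⟩ := hiter k
  refine ⟨μ, h1, h2, fun a => (h3 a).trans ?_⟩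
  have : 0 ≤ ∑ j, μ j * ‖a j‖ ^ 2 :=
    Finset.sum_nonneg fun j _ => mul_nonneg (h1 j) (by positivity)
  refine mul_le_mul_of_nonneg_right ?_ this
  linarith

/-- In a space of cotype `2`, a weakly `1`-summable family is a diagonal multiple of a family
which is weakly `2`-summable for the diagonal weights. -/
theorem HasCotype.exists_weights (hE : HasCotype 2 E) :
    ∃ K : ℝ, 0 ≤ K ∧ ∀ (m : ℕ) (x : Fin m → E), ∃ (μ : Fin m → ℝ) (t : Fin m → E),
      (∀ j, 0 ≤ μ j) ∧ ∑ j, μ j ≤ 1 ∧ (∀ j, x j = (μ j : 𝕜) • t j) ∧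
      ∀ φ : StrongDual 𝕜 E, ‖φ‖ ≤ 1 →
        ∑ j, μ j * ‖φ (t j)‖ ^ 2 ≤ (K * weakNorm 𝕜 1 x) ^ 2 := by
  obtain ⟨C, hC0, hC⟩ := hE
  have hC' : ∀ (N : ℕ) (x : Fin N → E), ∑ i, ‖x i‖ ^ 2 ≤
      C ^ 2 * ((∑ ε : Fin N → ℤˣ, ‖∑ i, (ε i : ℤ) • x i‖ ^ 2) / 2 ^ N) := by
    intro N x
    have h := hC N x
    simp only [← Real.sqrt_eq_rpow, Real.rpow_two] at h
    have h2 := pow_le_pow_left₀ (Real.sqrt_nonneg _) h 2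
    rwa [mul_pow, Real.sq_sqrt (by positivity), Real.sq_sqrt (by positivity)] at h2
  -- Here `7 = √49`, and `D = C² + 1` is positive even when `C = 0`.
  refine ⟨7 * (C ^ 2 + 1), by positivity, fun m x => ?_⟩
  have hB0 := weakNorm_nonneg (𝕜 := 𝕜) 1 x
  have hux := fun (a : Fin m → 𝕜) (t : ℝ) (ht : 0 ≤ t) (ha : ∀ j, ‖a j‖ ≤ t) =>
    norm_sum_smul_le_weakNorm_one x a ha ht
  rcases hB0.eq_or_lt with hB | hB
  · refine ⟨0, 0, by simp, by simp, fun j => ?_, by simp [← hB]⟩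
    have := hux (Pi.single j 1) 1 zero_le_one fun i => by
      by_cases hij : i = j
      · subst hij; simp
      · simp [hij]
    rw [← hB, Finset.sum_eq_single j (by intro i _ hi; simp [hi]) (by simp)] at this
    simpa using this
  obtain ⟨μ, h1, h2, h3⟩ := exists_domination_of_cotype (D := C ^ 2 + 1) (by positivity)
    (by linarith) hB hC' (Fintype.linearCombination 𝕜 x) fun a t ht ha => by
      simpa [Fintype.linearCombination_apply] using hux a t ht ha
  simp only [Fintype.linearCombination_apply] at h3
  have hx0 : ∀ j, μ j = 0 → x j = 0 := by
    intro j hj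
    have := h3 (Pi.single j 1)
    rw [Finset.sum_eq_single j (by intro i _ hi; simp [hi]) (by simp),
      Finset.sum_eq_single j (by intro i _ hi; simp [hi]) (by simp)] at this
    simpa [hj] using this
  obtain ⟨t, hxt⟩ : ∃ t : Fin m → E, ∀ j, x j = (μ j : 𝕜) • t j := by
    refine ⟨fun j => (μ j : 𝕜)⁻¹ • x j, fun j => ?_⟩
    by_cases hj : μ j = 0
    · simp [hx0 j hj]
    · rw [smul_inv_smul₀ (by exact_mod_cast hj)]
  refine ⟨μ, t, h1, h2, hxt, fun φ hφ => ?_⟩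
  set S := ∑ j, μ j * ‖φ (t j)‖ ^ 2 with hS
  have hS0 : 0 ≤ S := Finset.sum_nonneg fun j _ => mul_nonneg (h1 j) (by positivity)
  -- Duality: on these coefficients `S ≤ ‖u a‖`, while domination gives `‖u a‖² ≤ (K B)² S`;
  -- dividing by `S` finishes.
  have h4 := h3 fun j => (starRingEnd 𝕜) (φ (t j))
  simp only [RCLike.norm_conj] at h4
  have h5 : (S : 𝕜) = φ (∑ j, (starRingEnd 𝕜) (φ (t j)) • x j) := by
    rw [map_sum, hS, RCLike.ofReal_sum]
    refine Finset.sum_congr rfl fun j _ => ?_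
    conv_rhs => rw [hxt j]
    rw [map_smul, map_smul, smul_eq_mul, smul_eq_mul, mul_left_comm, RCLike.conj_mul]
    push_cast
    rfl
  have h6 : S ≤ ‖∑ j, (starRingEnd 𝕜) (φ (t j)) • x j‖ := by
    have h7 : S = ‖(S : 𝕜)‖ := by rw [RCLike.norm_ofReal, abs_of_nonneg hS0]
    rw [h7, h5]
    simpa using φ.le_of_opNorm_le hφ (∑ j, (starRingEnd 𝕜) (φ (t j)) • x j)
  have h8 := (pow_le_pow_left₀ hS0 h6 2).trans h4
  rcases hS0.eq_or_lt with h0 | h0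
  · rw [← h0]; positivity
  · refine le_of_mul_le_mul_right ?_ h0
    rw [← hS] at h8
    nlinarith

end Domination


/-! ### From `r`-summing to `1`-summing in spaces of cotype `2` -/

section Cotype

theorem sum_prod_eq_prod_sum {n : ℕ} {m : Fin n → ℕ} (μ : ∀ k, Fin (m k) → ℝ) :
    ∑ j : (∀ k, Fin (m k)), ∏ k, μ k (j k) = ∏ k, ∑ i, μ k i := by
  rw [Finset.prod_univ_sum, Fintype.piFinset_univ]

theorem sum_mul_le_rpow_of_sum_le_one {ι : Type*} [Fintype ι] {w f : ι → ℝ} (hw : ∀ i, 0 ≤ w i)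
    (hw1 : ∑ i, w i ≤ 1) (hf : ∀ i, 0 ≤ f i) {p : ℝ} (hp : 1 ≤ p) :
    ∑ i, w i * f i ≤ (∑ i, w i * f i ^ p) ^ p⁻¹ := by
  refine (Real.inner_le_weight_mul_Lp_of_nonneg Finset.univ hp w f hw hf).trans ?_
  refine mul_le_of_le_one_left (Real.rpow_nonneg (Finset.sum_nonneg fun i _ =>
    mul_nonneg (hw i) (Real.rpow_nonneg (hf i) _)) _) ?_
  exact Real.rpow_le_one (Finset.sum_nonneg fun i _ => hw i) hw1
    (sub_nonneg.2 (inv_le_one_of_one_le₀ hp))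

variable {𝕜 : Type*} [RCLike 𝕜] {n : ℕ} {E : Fin n → Type*}
  [∀ k, NormedAddCommGroup (E k)] [∀ k, NormedSpace 𝕜 (E k)]
  {F : Type*} [NormedAddCommGroup F] [NormedSpace 𝕜 F]

theorem multipleSumming_subset_one (hE : ∀ k, HasCotype 2 (E k)) {r : ℝ} (hr1 : 1 ≤ r)
    (hr2 : r ≤ 2) : multipleSumming 𝕜 E F r ⊆ multipleSumming 𝕜 E F 1 := by
  rintro A ⟨C, hC0, hC⟩
  have hr0 : 0 < r := by linarith
  choose K hK0 hK using fun k => (hE k).exists_weights (𝕜 := 𝕜)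
  refine ⟨C * ∏ k, K k, mul_nonneg hC0 (Finset.prod_nonneg fun k _ => hK0 k), fun m x => ?_⟩
  choose μ t hμ0 hμ1 hx hφ using fun k => hK k (m k) (x k)
  have hW0 : ∀ j : (∀ k, Fin (m k)), 0 ≤ ∏ k, μ k (j k) := fun j =>
    Finset.prod_nonneg fun k _ => hμ0 k _
  have hW1 : ∑ j : (∀ k, Fin (m k)), ∏ k, μ k (j k) ≤ 1 := by
    rw [sum_prod_eq_prod_sum]
    exact Finset.prod_le_one (fun k _ => Finset.sum_nonneg fun i _ => hμ0 k i) fun k _ => hμ1 k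
  -- With exponent `1 / r`, both `‖φ (z k i)‖ ^ r` and `‖A (z ..)‖ ^ r` become integrands against
  -- the weights, so `r ≤ 2` and `1 ≤ r` each enter through one use of Jensen's inequality.
  let z : ∀ k, Fin (m k) → E k := fun k i => ((μ k i ^ r⁻¹ : ℝ) : 𝕜) • t k i
  have hz : ∀ k, weakNorm 𝕜 r (z k) ≤ K k * weakNorm 𝕜 1 (x k) := by
    intro k
    have hB : 0 ≤ K k * weakNorm 𝕜 1 (x k) := mul_nonneg (hK0 k) (weakNorm_nonneg _ _)
    refine weakNorm_le hB _ fun φ hφ1 => ?_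
    have h1 : ∀ i, ‖φ (z k i)‖ ^ r = μ k i * ‖φ (t k i)‖ ^ r := fun i => by
      have h0 := Real.rpow_nonneg (hμ0 k i) r⁻¹
      simp only [z, map_smul, norm_smul, RCLike.norm_ofReal, abs_of_nonneg h0]
      rw [Real.mul_rpow h0 (norm_nonneg _), Real.rpow_inv_rpow (hμ0 k i) hr0.ne']
    have h2 := sum_mul_le_rpow_of_sum_le_one (hμ0 k) (hμ1 k)
      (f := fun i => ‖φ (t k i)‖ ^ r) (fun i => by positivity) (p := 2 / r)
      (by rwa [le_div_iff₀ hr0, one_mul])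
    have h3 : ∀ i, (‖φ (t k i)‖ ^ r) ^ (2 / r) = ‖φ (t k i)‖ ^ 2 := fun i => by
      rw [← Real.rpow_mul (norm_nonneg _), mul_div_cancel₀ _ hr0.ne', Real.rpow_two]
    simp only [h3] at h2
    simp only [h1]
    have h4 : 0 ≤ ∑ i, μ k i * ‖φ (t k i)‖ ^ 2 :=
      Finset.sum_nonneg fun i _ => mul_nonneg (hμ0 k i) (by positivity)
    have h5 : 0 ≤ ∑ i, μ k i * ‖φ (t k i)‖ ^ r :=
      Finset.sum_nonneg fun i _ => mul_nonneg (hμ0 k i) (by positivity)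
    have h6 := h2.trans (Real.rpow_le_rpow h4 (hφ k φ hφ1) (by positivity))
    rw [← Real.rpow_natCast, ← Real.rpow_mul hB] at h6
    have h7 : ((2 : ℕ) : ℝ) * (2 / r)⁻¹ = r := by push_cast; field_simp
    rw [h7] at h6
    rw [one_div]
    exact (Real.rpow_inv_le_iff_of_pos h5 hB hr0).2 h6
  have hA : ∀ j : (∀ k, Fin (m k)), ‖A fun k => x k (j k)‖ =
      (∏ k, μ k (j k)) * ‖A fun k => t k (j k)‖ := fun j => by
    simp only [hx]
    rw [A.map_smul_univ, norm_smul, norm_prod]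
    congr 1
    exact Finset.prod_congr rfl fun k _ => by rw [RCLike.norm_ofReal, abs_of_nonneg (hμ0 _ _)]
  have hAz : ∀ j : (∀ k, Fin (m k)), ‖A fun k => z k (j k)‖ ^ r =
      (∏ k, μ k (j k)) * ‖A fun k => t k (j k)‖ ^ r := fun j => by
    simp only [z]
    have h0 : ∀ k, 0 ≤ μ k (j k) ^ r⁻¹ := fun k => Real.rpow_nonneg (hμ0 _ _) _
    rw [A.map_smul_univ, norm_smul, norm_prod,
      Real.mul_rpow (Finset.prod_nonneg fun _ _ => norm_nonneg _) (norm_nonneg _),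
      ← Real.finsetProd_rpow _ _ fun _ _ => norm_nonneg _]
    congr 1
    exact Finset.prod_congr rfl fun k _ => by
      rw [RCLike.norm_ofReal, abs_of_nonneg (h0 k), Real.rpow_inv_rpow (hμ0 _ _) hr0.ne']
  simp only [Real.rpow_one, div_one, hA]
  calc _ ≤ (∑ j : (∀ k, Fin (m k)), (∏ k, μ k (j k)) * ‖A fun k => t k (j k)‖ ^ r) ^ r⁻¹ :=
        sum_mul_le_rpow_of_sum_le_one hW0 hW1 (fun _ => norm_nonneg _) hr1
    _ ≤ C * ∏ k, weakNorm 𝕜 r (z k) := by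
        have := hC m z
        simpa only [hAz, one_div] using this
    _ ≤ C * ∏ k, (K k * weakNorm 𝕜 1 (x k)) :=
        mul_le_mul_of_nonneg_left (Finset.prod_le_prod (fun k _ => weakNorm_nonneg _ _)
          fun k _ => hz k) hC0
    _ = _ := by rw [Finset.prod_mul_distrib, mul_assoc]

end Cotype


/-! ### A discrete heavy-tailed substitute for `r`-stable variables -/

section Randomization

theorem sum_pow_le_of_one_lt {q X : ℝ} (hq : 1 < q) (hX : 0 ≤ X) (S : Finset ℕ)
    (h : ∀ i ∈ S, q ^ i ≤ X) : ∑ i ∈ S, q ^ i ≤ q / (q - 1) * X := by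
  have hq1 : 0 < q - 1 := by linarith
  rcases S.eq_empty_or_nonempty with rfl | hS
  · simp only [Finset.sum_empty]
    positivity
  have h1 : ∑ i ∈ S, q ^ i ≤ ∑ i ∈ Finset.range (S.max' hS + 1), q ^ i :=
    Finset.sum_le_sum_of_subset_of_nonneg
      (fun i hi => Finset.mem_range.2 (Nat.lt_succ_of_le (S.le_max' i hi)))
      fun _ _ _ => by positivity
  refine h1.trans ?_
  rw [geom_sum_eq hq.ne', div_mul_eq_mul_div, div_le_div_iff_of_pos_right hq1, pow_succ]
  have := h _ (S.max'_mem hS)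
  nlinarith

theorem sum_pow_le_of_lt_one {q X : ℝ} (hq0 : 0 ≤ q) (hq : q < 1) (hX : 0 ≤ X) (S : Finset ℕ)
    (h : ∀ i ∈ S, q ^ i ≤ X) : ∑ i ∈ S, q ^ i ≤ 1 / (1 - q) * X := by
  have hq1 : 0 < 1 - q := by linarith
  rcases S.eq_empty_or_nonempty with rfl | hS
  · simp only [Finset.sum_empty]
    positivity
  have h1 : ∑ i ∈ S, q ^ i ≤ ∑ i ∈ Finset.Ico (S.min' hS) (S.max' hS + 1), q ^ i :=
    Finset.sum_le_sum_of_subset_of_nonneg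
      (fun i hi => Finset.mem_Ico.2 ⟨S.min'_le i hi, Nat.lt_succ_of_le (S.le_max' i hi)⟩)
      fun _ _ _ => by positivity
  refine (h1.trans (geom_sum_Ico_le_of_lt_one hq0 hq)).trans ?_
  rw [div_mul_eq_mul_div, one_mul, div_le_div_iff_of_pos_right hq1]
  exact h _ (S.min'_mem hS)

/-- A truncated moment bound for a dyadic random variable with tail of order `t ^ (-r)`. -/
theorem exists_sum_dyadic_min_le {r : ℝ} (hr1 : 1 < r) (hr2 : r < 2) :
    ∃ c : ℝ, 0 ≤ c ∧ ∀ (M : ℕ) (β : ℝ), 0 ≤ β →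
      ∑ i ∈ Finset.range M, (1 / 2 : ℝ) ^ (i + 1) *
        min (β * ((2 : ℝ) ^ (1 / r)) ^ i) ((β * ((2 : ℝ) ^ (1 / r)) ^ i) ^ 2) ≤ c * β ^ r := by
  have hr0 : 0 < r := by linarith
  set ρ : ℝ := (2 : ℝ) ^ (1 / r) with hρ
  have hρ1 : 1 < ρ := Real.one_lt_rpow (by norm_num) (by positivity)
  have hρ0 : 0 < ρ := by linarith
  have hρr : ρ ^ r = 2 := by
    rw [hρ, ← Real.rpow_mul (by norm_num), one_div_mul_cancel hr0.ne', Real.rpow_one]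
  set q₂ := ρ ^ (2 - r) with hq₂
  set q₁ := ρ ^ (1 - r) with hq₁
  have h₂ : 1 < q₂ := Real.one_lt_rpow hρ1 (by linarith)
  have h₁ : q₁ < 1 := Real.rpow_lt_one_of_one_lt_of_neg hρ1 (by linarith)
  have h₁0 : 0 < q₁ := by positivity
  have e₂ : q₂ = ρ ^ 2 * (1 / 2) := by
    rw [hq₂, Real.rpow_sub hρ0, hρr, Real.rpow_two]; ring
  have e₁ : q₁ = ρ * (1 / 2) := by
    rw [hq₁, Real.rpow_sub hρ0, hρr, Real.rpow_one]; ring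
  have h₂' : 0 < q₂ - 1 := by linarith
  have h₁' : 0 < 1 - q₁ := by linarith
  refine ⟨q₂ / (q₂ - 1) + 1 / (1 - q₁), by positivity, fun M β hβ => ?_⟩
  rcases hβ.eq_or_lt with rfl | hβ
  · simp [Real.zero_rpow hr0.ne']
  -- Below the crossover the terms grow like `ρ ^ (2 - r)`, above it they decay like `ρ ^ (1 - r)`,
  -- so each geometric sum is of the size of its term near `ρ ^ i = 1 / β`, namely `β ^ r`. Both `1
  -- < r` and `r < 2` are essential.
  rw [← Finset.sum_filter_add_sum_filter_not _ fun i => β * ρ ^ i ≤ 1, add_mul]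
  refine add_le_add ?_ ?_
  · calc _ ≤ ∑ i ∈ (Finset.range M).filter fun i => β * ρ ^ i ≤ 1, β ^ 2 * q₂ ^ i := by
          refine Finset.sum_le_sum fun i _ => ?_
          calc _ ≤ (1 / 2 : ℝ) ^ i * (β * ρ ^ i) ^ 2 := by
                refine mul_le_mul (pow_le_pow_of_le_one (by norm_num) (by norm_num)
                  (Nat.le_succ i)) (min_le_right _ _) (by positivity) (by positivity)
            _ = _ := by rw [e₂]; ring
      _ = β ^ 2 * ∑ i ∈ (Finset.range M).filter fun i => β * ρ ^ i ≤ 1, q₂ ^ i := by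
          rw [Finset.mul_sum]
      _ ≤ β ^ 2 * (q₂ / (q₂ - 1) * (β⁻¹) ^ (2 - r)) := by
          refine mul_le_mul_of_nonneg_left (sum_pow_le_of_one_lt h₂ (by positivity) _ ?_)
            (by positivity)
          intro i hi
          have hi := (Finset.mem_filter.1 hi).2
          rw [hq₂, ← Real.rpow_mul_natCast hρ0.le, mul_comm, Real.rpow_natCast_mul hρ0.le]
          refine Real.rpow_le_rpow (by positivity) ?_ (by linarith)
          rwa [← one_div, le_div_iff₀' hβ]
      _ = _ := by
          rw [Real.inv_rpow hβ.le, Real.rpow_sub hβ, Real.rpow_two]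
          field_simp
  · calc _ ≤ ∑ i ∈ (Finset.range M).filter fun i => ¬ β * ρ ^ i ≤ 1, β * q₁ ^ i := by
          refine Finset.sum_le_sum fun i _ => ?_
          calc _ ≤ (1 / 2 : ℝ) ^ i * (β * ρ ^ i) := by
                refine mul_le_mul (pow_le_pow_of_le_one (by norm_num) (by norm_num)
                  (Nat.le_succ i)) (min_le_left _ _) (by positivity) (by positivity)
            _ = _ := by rw [e₁]; ring
      _ = β * ∑ i ∈ (Finset.range M).filter fun i => ¬ β * ρ ^ i ≤ 1, q₁ ^ i := by
          rw [Finset.mul_sum]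
      _ ≤ β * (1 / (1 - q₁) * (β⁻¹) ^ (1 - r)) := by
          refine mul_le_mul_of_nonneg_left (sum_pow_le_of_lt_one h₁0.le h₁ (by positivity) _ ?_)
            hβ.le
          intro i hi
          have hi := (Finset.mem_filter.1 hi).2
          rw [hq₁, ← Real.rpow_mul_natCast hρ0.le, mul_comm, Real.rpow_natCast_mul hρ0.le]
          refine Real.rpow_le_rpow_of_nonpos (by positivity) ?_ (by linarith)
          rw [← one_div, div_le_iff₀' hβ]
          exact (not_le.1 hi).le
      _ = _ := by
          rw [Real.inv_rpow hβ.le, Real.rpow_sub hβ, Real.rpow_one]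
          field_simp

/-- A finitely supported random variable `θ`, with distribution `w`, whose tail is of order
`t ^ (-r)` up to the level `2 ^ (M / r)`. -/
theorem exists_heavy_tailed {r : ℝ} (hr1 : 1 < r) (hr2 : r < 2) :
    ∃ c : ℝ, 0 ≤ c ∧ ∀ M : ℕ, ∃ w θ : Fin (M + 1) → ℝ, (∀ i, 0 ≤ w i) ∧ (∀ i, 0 ≤ θ i) ∧
      ∑ i, w i = 1 ∧
      (∀ β : ℝ, 0 ≤ β → ∑ i, w i * min (β * θ i) ((β * θ i) ^ 2) ≤ c * β ^ r) ∧
      ∀ τ : ℝ, 0 ≤ τ → τ ≤ 1 →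
        (τ ^ r - 2 * (1 / 2) ^ M) / 4 ≤ ∑ i, if 1 ≤ τ * θ i then w i else 0 := by
  have hr0 : 0 < r := by linarith
  obtain ⟨c, hc0, hc⟩ := exists_sum_dyadic_min_le hr1 hr2
  set ρ : ℝ := (2 : ℝ) ^ (1 / r) with hρ
  have hρ0 : 0 < ρ := by positivity
  have hρr : ρ ^ r = 2 := by
    rw [hρ, ← Real.rpow_mul (by norm_num), one_div_mul_cancel hr0.ne', Real.rpow_one]
  -- The mass `2 ^ (-M)` left over by truncation sits at the value `0`.
  refine ⟨c, hc0, fun M => ⟨Fin.cons ((1 / 2) ^ M) fun i : Fin M => (1 / 2) ^ ((i : ℕ) + 1),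
    Fin.cons 0 fun i : Fin M => ρ ^ (i : ℕ), ?_, ?_, ?_, fun β hβ => ?_, fun τ hτ0 hτ1 => ?_⟩⟩
  · refine Fin.cases ?_ fun i => ?_ <;> simp
  · refine Fin.cases ?_ fun i => ?_ <;> simp [hρ0.le]
  · rw [Fin.sum_univ_succ]
    simp only [Fin.cons_zero, Fin.cons_succ]
    rw [Fin.sum_univ_eq_sum_range fun i => (1 / 2 : ℝ) ^ (i + 1)]
    simp only [pow_succ, ← Finset.sum_mul]
    rw [geom_sum_eq (by norm_num)]
    ring
  · rw [Fin.sum_univ_succ]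
    simp only [Fin.cons_zero, Fin.cons_succ]
    rw [Fin.sum_univ_eq_sum_range fun i => (1 / 2 : ℝ) ^ (i + 1) *
      min (β * ρ ^ i) ((β * ρ ^ i) ^ 2)]
    simpa using hc M β hβ
  · set w : Fin (M + 1) → ℝ := Fin.cons ((1 / 2) ^ M) fun i : Fin M => (1 / 2) ^ ((i : ℕ) + 1)
      with hw
    have hw0 : ∀ i, 0 ≤ w i := by refine Fin.cases ?_ fun i => ?_ <;> simp [hw]
    set σ := τ ^ r with hσ
    have hσ0 : 0 ≤ σ := by positivity
    have hσ1 : σ ≤ 1 := Real.rpow_le_one hτ0 hτ1 hr0.le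
    have hiff : ∀ i : ℕ, 1 ≤ 2 ^ i * σ → 1 ≤ τ * ρ ^ i := by
      intro i hi
      have h1 : (τ * ρ ^ i) ^ r = 2 ^ i * σ := by
        rw [Real.mul_rpow hτ0 (by positivity), ← Real.rpow_natCast_mul hρ0.le, mul_comm (i : ℝ),
          Real.rpow_mul_natCast hρ0.le, hρr, mul_comm]
      rw [← h1] at hi
      by_contra! hlt
      exact absurd hi (not_le.2 (Real.rpow_lt_one (by positivity) hlt hr0))
    have hnn : 0 ≤ ∑ i, if 1 ≤ τ * (Fin.cons 0 fun i : Fin M => ρ ^ (i : ℕ) :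
        Fin (M + 1) → ℝ) i then w i else 0 :=
      Finset.sum_nonneg fun i _ => by split_ifs <;> simp [hw0]
    -- One atom suffices: the first `i` with `2 ^ i * σ ≥ 1` has mass at least `σ / 4`. If no level
    -- below `M` qualifies, the claimed lower bound is nonpositive.
    by_cases hM : ∃ i, i < M ∧ 1 ≤ 2 ^ i * σ
    · classical
      obtain ⟨hi1, hi2⟩ := Nat.find_spec hM
      have hmin := fun j => Nat.find_min hM (m := j)
      set i₀ := Nat.find hM
      have h1 : (1 / 2 : ℝ) ^ (i₀ + 1) ≤ ∑ i, if 1 ≤ τ * (Fin.cons 0 fun i : Fin M => ρ ^ (i : ℕ) :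
          Fin (M + 1) → ℝ) i then w i else 0 := by
        refine le_trans (le_of_eq ?_) (Finset.single_le_sum (fun i _ => by
          split_ifs <;> simp [hw0]) (Finset.mem_univ (Fin.succ ⟨i₀, hi1⟩)))
        simp only [hw, Fin.cons_succ, if_pos (hiff i₀ hi2)]
      refine le_trans ?_ h1
      have h2 : (0 : ℝ) ≤ (1 / 2) ^ M := by positivity
      rcases Nat.eq_zero_or_pos i₀ with h0 | h0
      · rw [h0]
        norm_num
        linarith
      · have h3 := hmin (i₀ - 1) (by omega)
        have h4 : 2 ^ (i₀ - 1) * σ < 1 := by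
          by_contra! hge
          exact h3 ⟨by omega, hge⟩
        have h5 : i₀ + 1 = (i₀ - 1) + 2 := by omega
        rw [h5, pow_add]
        have h6 : (1 / 2 : ℝ) ^ (i₀ - 1) * 2 ^ (i₀ - 1) = 1 := by
          rw [← mul_pow]; norm_num
        have h7 : (0 : ℝ) < (1 / 2) ^ (i₀ - 1) := by positivity
        have h8 : σ ≤ (1 / 2) ^ (i₀ - 1) := by nlinarith
        linarith
    · push Not at hM
      refine le_trans (div_nonpos_of_nonpos_of_nonneg ?_ (by norm_num)) hnn
      rw [sub_nonpos]
      rcases M with _ | M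
      · norm_num
        linarith
      · have h1 := hM M (Nat.lt_succ_self M)
        have h2 : (1 / 2 : ℝ) ^ M * 2 ^ M = 1 := by
          rw [← mul_pow]; norm_num
        have h3 : (0 : ℝ) < (1 / 2) ^ M := by positivity
        rw [pow_succ]
        nlinarith

theorem sum_pi_prod_mul {m : ℕ} {ι : Type*} [Fintype ι] {w : ι → ℝ} (hw : ∑ i, w i = 1)
    (g : ι → ℝ) (j : Fin m) :
    ∑ ω : Fin m → ι, (∏ k, w (ω k)) * g (ω j) = ∑ i, w i * g i := by
  classical
  have h := Finset.prod_univ_sum (fun _ : Fin m => (Finset.univ : Finset ι))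
    fun k i => w i * if k = j then g i else 1
  rw [Fintype.piFinset_univ] at h
  simp only [Finset.prod_mul_distrib, Finset.prod_ite_eq', Finset.mem_univ, if_true] at h
  rw [← h, Finset.prod_eq_single j]
  · simp
  · intro k _ hk
    simp [hk, hw]
  · simp

/-- By independence the probability that no event occurs is `∏ (1 - p_j) ≤ exp (-∑ p_j)`. -/
theorem one_sub_exp_le_sum_pi {m : ℕ} {ι : Type*} [Fintype ι] {w : ι → ℝ}
    (hw0 : ∀ i, 0 ≤ w i) (hw : ∑ i, w i = 1) (P : Fin m → ι → Prop)
    [∀ j i, Decidable (P j i)] :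
    1 - Real.exp (-∑ j, ∑ i, if P j i then w i else 0) ≤
      ∑ ω : Fin m → ι, if ∃ j, P j (ω j) then ∏ k, w (ω k) else 0 := by
  have h1 : ∑ ω : Fin m → ι, (if ∃ j, P j (ω j) then ∏ k, w (ω k) else 0) +
      ∑ ω : Fin m → ι, (∏ k, if P k (ω k) then 0 else w (ω k)) = 1 := by
    have h := Finset.prod_univ_sum (fun _ : Fin m => (Finset.univ : Finset ι)) fun _ i => w i
    rw [Fintype.piFinset_univ] at h
    simp only [hw, Finset.prod_const_one] at h
    rw [h, ← Finset.sum_add_distrib]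
    refine Finset.sum_congr rfl fun ω _ => ?_
    by_cases hω : ∃ j, P j (ω j)
    · obtain ⟨j, hj⟩ := id hω
      rw [if_pos hω,
        Finset.prod_eq_zero (f := fun k => if P k (ω k) then 0 else w (ω k))
          (Finset.mem_univ j) (if_pos hj), add_zero]
    · rw [if_neg hω, zero_add]
      push Not at hω
      exact Finset.prod_congr rfl fun k _ => if_neg (hω k)
  have h2 : ∑ ω : Fin m → ι, (∏ k, if P k (ω k) then 0 else w (ω k)) =
      ∏ k, ∑ i, if P k i then 0 else w i := by
    rw [Finset.prod_univ_sum, Fintype.piFinset_univ]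
  have h3 : ∏ k, (∑ i, if P k i then 0 else w i) ≤
      Real.exp (-∑ j, ∑ i, if P j i then w i else 0) := by
    rw [← Finset.sum_neg_distrib, Real.exp_sum]
    refine Finset.prod_le_prod (fun k _ => Finset.sum_nonneg fun i _ => by
      split_ifs <;> simp [hw0]) fun k _ => ?_
    have h4 : ∑ i, (if P k i then 0 else w i) = -(∑ i, if P k i then w i else 0) + 1 := by
      rw [← hw, ← Finset.sum_neg_distrib, ← Finset.sum_add_distrib]
      refine Finset.sum_congr rfl fun i _ => ?_
      split_ifs <;> simp
    rw [h4]
    exact Real.add_one_le_exp _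
  linarith

/-- Makes the square function additive in `j`, so that its expectation needs only the one-variable
truncated moments. -/
theorem sqrt_sum_sq_le {m : ℕ} {T : Fin m → ℝ} (hT : ∀ j, 0 ≤ T j) :
    √(∑ j, T j ^ 2) ≤ 1 + ∑ j, min (T j) (T j ^ 2) := by
  have h0 : ∀ j, 0 ≤ min (T j) (T j ^ 2) := fun j => le_min (hT j) (by positivity)
  set H := ∑ j, min (T j) (T j ^ 2) with hH
  have hH0 : 0 ≤ H := Finset.sum_nonneg fun j _ => h0 j
  refine Real.sqrt_le_iff.2 ⟨by positivity, ?_⟩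
  calc ∑ j, T j ^ 2 ≤ ∑ j, (min (T j) (T j ^ 2) + H * min (T j) (T j ^ 2)) := by
        refine Finset.sum_le_sum fun j _ => ?_
        have h1 : min (T j) (T j ^ 2) ≤ H :=
          Finset.single_le_sum (fun j _ => h0 j) (Finset.mem_univ j)
        have h2 := mul_le_mul_of_nonneg_right h1 (h0 j)
        rcases le_total (T j) 1 with h | h
        · have : min (T j) (T j ^ 2) = T j ^ 2 := min_eq_right (by nlinarith [hT j])
          rw [this] at h2 ⊢
          nlinarith [sq_nonneg (T j ^ 2)]
        · have : min (T j) (T j ^ 2) = T j := min_eq_left (by nlinarith [hT j])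
          rw [this] at h2 ⊢
          nlinarith [hT j]
    _ = H + H * H := by rw [Finset.sum_add_distrib, ← Finset.mul_sum]
    _ ≤ (1 + H) ^ 2 := by nlinarith

end Randomization


/-! ### From `1`-summing to `r`-summing by randomization -/

section Inclusion

universe u

theorem norm_sum_weighted_signs (𝕜 : Type*) [RCLike 𝕜] {V : Type*} [NormedAddCommGroup V]
    [NormedSpace 𝕜 V] {m : ℕ} {c : ℝ} (hc : 0 ≤ c) (ε : Fin m → ℤˣ) (t : Fin m → ℝ)
    (v : Fin m → V) :
    ‖∑ j, (((c * t j : ℝ) : 𝕜) * ((ε j : ℤ) : 𝕜)) • v j‖ =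
      c * ‖∑ j, (ε j : ℤ) • ((t j : 𝕜) • v j)‖ := by
  have h : ∑ j, (((c * t j : ℝ) : 𝕜) * ((ε j : ℤ) : 𝕜)) • v j =
      (c : 𝕜) • ∑ j, (ε j : ℤ) • ((t j : 𝕜) • v j) := by
    rw [Finset.smul_sum]
    refine Finset.sum_congr rfl fun j _ => ?_
    rw [← Int.cast_smul_eq_zsmul 𝕜, smul_smul, smul_smul]
    push_cast
    congr 1
    ring
  rw [h, norm_smul, RCLike.norm_ofReal, abs_of_nonneg hc]

theorem exists_normalized_randomization (𝕜 : Type*) [RCLike 𝕜] {r : ℝ} (hr1 : 1 < r)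
    (hr2 : r < 2) :
    ∃ C : ℝ, 0 ≤ C ∧ ∀ m : ℕ, ∃ (N : ℕ) (Θ : Fin N → Fin m → 𝕜),
      (∀ b : Fin m → 𝕜, ∑ j, ‖b j‖ ^ r = 1 → ∑ ω, ‖∑ j, Θ ω j * b j‖ ≤ C) ∧
      ∀ (V : Type u) [NormedAddCommGroup V] [NormedSpace 𝕜 V] (v : Fin m → V),
        ∑ j, ‖v j‖ ^ r = 1 → 1 ≤ C * ∑ ω, ‖∑ j, Θ ω j • v j‖ := by
  have hr0 : 0 < r := by linarith
  obtain ⟨c, hc0, hc⟩ := exists_heavy_tailed hr1 hr2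
  have hexp : Real.exp (-(1 / 8)) < 1 := Real.exp_lt_one_iff.2 (by norm_num)
  have hd : 0 < 1 - Real.exp (-(1 / 8)) := by linarith
  refine ⟨max (1 + c) (1 - Real.exp (-(1 / 8)))⁻¹, le_max_of_le_left (by linarith), fun m => ?_⟩
  -- Level `m + 2` makes the truncation error, summed over `m` coordinates, at most half of the main
  -- term; hence the `1 / 8` below.
  obtain ⟨w, θ, hw0, hθ0, hw1, hup, hlow⟩ := hc (m + 2)
  let W : (Fin m → Fin (m + 2 + 1)) → ℝ := fun ω => ∏ k, w (ω k)
  have hW0 : ∀ ω, 0 ≤ W ω := fun ω => Finset.prod_nonneg fun k _ => hw0 _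
  have hW1 : ∑ ω, W ω = 1 := by
    have h := Finset.prod_univ_sum
      (fun _ : Fin m => (Finset.univ : Finset (Fin (m + 2 + 1)))) fun _ i => w i
    rw [Fintype.piFinset_univ] at h
    simp only [hw1, Finset.prod_const_one] at h
    exact h.symm
  let Ω := (Fin m → Fin (m + 2 + 1)) × (Fin m → ℤˣ)
  -- The probability of `ω` is built into the coefficient, so plain sums over `ω` are expectations.
  let Θ : Ω → Fin m → 𝕜 := fun ω j =>
    ((W ω.1 / 2 ^ m * θ (ω.1 j) : ℝ) : 𝕜) * ((ω.2 j : ℤ) : 𝕜)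
  have hsum : ∀ (V : Type u) [NormedAddCommGroup V] [NormedSpace 𝕜 V] (v : Fin m → V),
      ∑ ω : Ω, ‖∑ j, Θ ω j • v j‖ = ∑ ω, W ω / 2 ^ m *
        ∑ ε : Fin m → ℤˣ, ‖∑ j, (ε j : ℤ) • ((θ (ω j) : 𝕜) • v j)‖ := by
    intro V _ _ v
    rw [Fintype.sum_prod_type]
    simp only [Finset.mul_sum]
    exact Finset.sum_congr rfl fun ω _ => Finset.sum_congr rfl fun ε _ =>
      norm_sum_weighted_signs 𝕜 (div_nonneg (hW0 ω) (by positivity)) ε _ v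
  have hsum' : ∀ b : Fin m → 𝕜,
      ∑ ω : Ω, ‖∑ j, Θ ω j * b j‖ = ∑ ω, W ω / 2 ^ m *
        ∑ ε : Fin m → ℤˣ, ‖∑ j, (ε j : ℤ) • ((θ (ω j) : 𝕜) * b j)‖ := by
    intro b
    rw [Fintype.sum_prod_type]
    simp only [Finset.mul_sum]
    exact Finset.sum_congr rfl fun ω _ => Finset.sum_congr rfl fun ε _ =>
      norm_sum_weighted_signs 𝕜 (div_nonneg (hW0 ω) (by positivity)) ε _ b
  refine ⟨Fintype.card Ω, fun ω => Θ ((Fintype.equivFin Ω).symm ω), fun b hb => ?_,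
    fun V _ _ v hv => ?_⟩
  · rw [Equiv.sum_comp (Fintype.equivFin Ω).symm fun ω => ‖∑ j, Θ ω j * b j‖, hsum']
    refine le_trans ?_ (le_max_left _ _)
    calc _ ≤ ∑ ω, W ω * (1 + ∑ j, min (‖b j‖ * θ (ω j)) ((‖b j‖ * θ (ω j)) ^ 2)) := by
          refine Finset.sum_le_sum fun ω _ => ?_
          rw [div_mul_eq_mul_div, mul_div_assoc]
          refine mul_le_mul_of_nonneg_left ?_ (hW0 ω)
          rw [div_le_iff₀' (by positivity)]
          refine (sum_signs_norm_le _).trans ?_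
          refine mul_le_mul_of_nonneg_left ?_ (by positivity)
          have h1 : ∀ j, ‖(θ (ω j) : 𝕜) * b j‖ = ‖b j‖ * θ (ω j) := fun j => by
            rw [norm_mul, RCLike.norm_ofReal, abs_of_nonneg (hθ0 _), mul_comm]
          simp only [h1]
          exact sqrt_sum_sq_le fun j => mul_nonneg (norm_nonneg _) (hθ0 _)
      _ = 1 + ∑ j, ∑ i, w i * min (‖b j‖ * θ i) ((‖b j‖ * θ i) ^ 2) := by
          simp only [mul_add, mul_one, Finset.sum_add_distrib, hW1, Finset.mul_sum]
          rw [Finset.sum_comm]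
          congr 1
          exact Finset.sum_congr rfl fun j _ =>
            sum_pi_prod_mul hw1 (fun i => min (‖b j‖ * θ i) ((‖b j‖ * θ i) ^ 2)) j
      _ ≤ 1 + ∑ j, c * ‖b j‖ ^ r := by
          gcongr with j _
          exact hup _ (norm_nonneg _)
      _ = 1 + c := by rw [← Finset.mul_sum, hb, mul_one]
  · rw [Equiv.sum_comp (Fintype.equivFin Ω).symm fun ω => ‖∑ j, Θ ω j • v j‖, hsum]
    have hv1 : ∀ j, ‖v j‖ ≤ 1 := fun j => by
      have h1 : ‖v j‖ ^ r ≤ 1 := by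
        rw [← hv]
        exact Finset.single_le_sum (f := fun j => ‖v j‖ ^ r) (fun _ _ => by positivity)
          (Finset.mem_univ j)
      by_contra! h2
      exact absurd h1 (not_le.2 (Real.one_lt_rpow h2 hr0))
    have hp : 1 / 8 ≤ ∑ j, ∑ i, if 1 ≤ ‖v j‖ * θ i then w i else 0 := by
      refine le_trans ?_ (Finset.sum_le_sum fun j _ => hlow ‖v j‖ (norm_nonneg _) (hv1 j))
      rw [← Finset.sum_div, Finset.sum_sub_distrib, hv, Finset.sum_const, Finset.card_univ,
        Fintype.card_fin, nsmul_eq_mul, pow_add]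
      have h1 : (m : ℝ) ≤ 2 ^ m := by exact_mod_cast Nat.lt_two_pow_self.le
      have h2 : (m : ℝ) * (1 / 2) ^ m ≤ 1 := by
        rw [div_pow, one_pow, mul_one_div]
        exact div_le_one_of_le₀ h1 (by positivity)
      linarith
    have h1 := one_sub_exp_le_sum_pi hw0 hw1 fun j i => 1 ≤ ‖v j‖ * θ i
    have h2 : 1 - Real.exp (-(1 / 8)) ≤ ∑ ω, W ω / 2 ^ m *
        ∑ ε : Fin m → ℤˣ, ‖∑ j, (ε j : ℤ) • ((θ (ω j) : 𝕜) • v j)‖ := by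
      have h3 := Real.exp_le_exp.2 (neg_le_neg hp)
      refine le_trans (by linarith) (h1.trans (Finset.sum_le_sum fun ω _ => ?_))
      split_ifs with hω
      · obtain ⟨j, hj⟩ := hω
        rw [div_mul_eq_mul_div, mul_div_assoc]
        refine le_mul_of_one_le_right (hW0 ω) ?_
        rw [le_div_iff₀ (by positivity), one_mul]
        refine le_trans ?_ (norm_le_sum_signs 𝕜 _ j)
        rw [norm_smul, RCLike.norm_ofReal, abs_of_nonneg (hθ0 _), mul_comm (θ _)]
        exact le_mul_of_one_le_right (by positivity) hj
      · exact mul_nonneg (div_nonneg (hW0 ω) (by positivity))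
          (Finset.sum_nonneg fun _ _ => norm_nonneg _)
    calc 1 = (1 - Real.exp (-(1 / 8)))⁻¹ * (1 - Real.exp (-(1 / 8))) :=
          (inv_mul_cancel₀ hd.ne').symm
      _ ≤ _ := mul_le_mul (le_max_right _ _) h2 hd.le (le_max_of_le_left (by linarith))

theorem sum_norm_inv_smul_rpow {𝕜 : Type*} [RCLike 𝕜] {r : ℝ} (hr : 0 < r) {m : ℕ} {V : Type*}
    [NormedAddCommGroup V] [NormedSpace 𝕜 V] (v : Fin m → V)
    (h : 0 < (∑ j, ‖v j‖ ^ r) ^ (1 / r)) :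
    ∑ j, ‖((((∑ j, ‖v j‖ ^ r) ^ (1 / r))⁻¹ : ℝ) : 𝕜) • v j‖ ^ r = 1 := by
  have hs : 0 ≤ ∑ j, ‖v j‖ ^ r := Finset.sum_nonneg fun _ _ => by positivity
  have h1 : ∀ j, ‖((((∑ j, ‖v j‖ ^ r) ^ (1 / r))⁻¹ : ℝ) : 𝕜) • v j‖ ^ r =
      (∑ j, ‖v j‖ ^ r)⁻¹ * ‖v j‖ ^ r := fun j => by
    rw [norm_smul, RCLike.norm_ofReal, abs_of_pos (inv_pos.2 h),
      Real.mul_rpow (inv_pos.2 h).le (norm_nonneg _), Real.inv_rpow h.le, one_div,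
      Real.rpow_inv_rpow hs hr.ne']
  simp only [h1]
  rw [← Finset.mul_sum, inv_mul_cancel₀]
  intro h0
  rw [h0, Real.zero_rpow (by positivity)] at h
  exact lt_irrefl _ h

/-- `ℓ_r^m` embeds into some finite-dimensional `ℓ_1` uniformly in `m`, with a lower estimate
that holds for vector-valued families. -/
theorem exists_randomization (𝕜 : Type*) [RCLike 𝕜] {r : ℝ} (hr1 : 1 < r) (hr2 : r < 2) :
    ∃ C : ℝ, 0 ≤ C ∧ ∀ m : ℕ, ∃ (N : ℕ) (Θ : Fin N → Fin m → 𝕜),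
      (∀ b : Fin m → 𝕜, ∑ ω, ‖∑ j, Θ ω j * b j‖ ≤ C * (∑ j, ‖b j‖ ^ r) ^ (1 / r)) ∧
      ∀ (V : Type u) [NormedAddCommGroup V] [NormedSpace 𝕜 V] (v : Fin m → V),
        (∑ j, ‖v j‖ ^ r) ^ (1 / r) ≤ C * ∑ ω, ‖∑ j, Θ ω j • v j‖ := by
  have hr0 : 0 < r := by linarith
  obtain ⟨C, hC0, hC⟩ := exists_normalized_randomization.{u} 𝕜 hr1 hr2
  refine ⟨C, hC0, fun m => ?_⟩
  obtain ⟨N, Θ, h1, h2⟩ := hC m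
  refine ⟨N, Θ, fun b => ?_, fun V _ _ v => ?_⟩
  · have hs : 0 ≤ ∑ j, ‖b j‖ ^ r := Finset.sum_nonneg fun _ _ => by positivity
    rcases (Real.rpow_nonneg hs (1 / r)).eq_or_lt with h | h
    · have hs0 := (Real.rpow_eq_zero hs (by positivity)).1 h.symm
      have hb : ∀ j, b j = 0 := fun j => by
        have := (Finset.sum_eq_zero_iff_of_nonneg fun _ _ => by positivity).1 hs0 j
          (Finset.mem_univ j)
        simpa [Real.rpow_eq_zero (norm_nonneg _) hr0.ne'] using this
      rw [← h]
      simp [hb]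
    · have h3 := h1 _ (sum_norm_inv_smul_rpow (𝕜 := 𝕜) hr0 b h)
      simp only [smul_eq_mul, mul_left_comm (Θ _ _), ← Finset.mul_sum, norm_mul,
        RCLike.norm_ofReal, abs_of_pos (inv_pos.2 h)] at h3
      rwa [inv_mul_le_iff₀ h, mul_comm] at h3
  · rcases (Real.rpow_nonneg (Finset.sum_nonneg fun _ _ => by positivity :
      0 ≤ ∑ j, ‖v j‖ ^ r) (1 / r)).eq_or_lt with h | h
    · rw [← h]
      positivity
    · have h3 := h2 V _ (sum_norm_inv_smul_rpow (𝕜 := 𝕜) hr0 v h)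
      simp only [smul_comm (Θ _ _), ← Finset.smul_sum, norm_smul, ← Finset.mul_sum,
        RCLike.norm_ofReal, abs_of_pos (inv_pos.2 h)] at h3
      rw [mul_left_comm, le_inv_mul_iff₀ h, mul_one] at h3
      exact h3

/-- Induction on `n`: the first index is absorbed into the target, replacing `V` by `ℓ_r^{m 0}(V)`,
and is then randomized itself. This is why the lower estimate is required for every `V`. -/
theorem rpow_sum_le_sum_randomized {𝕜 : Type*} [RCLike 𝕜] {r C : ℝ} (hr : 1 ≤ r) (hC : 0 ≤ C)
    {n : ℕ} (m N : Fin n → ℕ) (Θ : ∀ k, Fin (N k) → Fin (m k) → 𝕜)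
    (hΘ : ∀ k, ∀ (V : Type u) [NormedAddCommGroup V] [NormedSpace 𝕜 V] (v : Fin (m k) → V),
      (∑ j, ‖v j‖ ^ r) ^ (1 / r) ≤ C * ∑ ω, ‖∑ j, Θ k ω j • v j‖)
    (V : Type u) [NormedAddCommGroup V] [NormedSpace 𝕜 V] (a : (∀ k, Fin (m k)) → V) :
    (∑ j, ‖a j‖ ^ r) ^ (1 / r) ≤
      C ^ n * ∑ ω : (∀ k, Fin (N k)), ‖∑ j, (∏ k, Θ k (ω k) (j k)) • a j‖ := by
  have hr0 : 0 < r := by linarith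
  induction n generalizing V with
  | zero =>
    simp only [Fintype.sum_unique, Finset.univ_eq_empty, Finset.prod_empty, one_smul, pow_zero,
      one_mul]
    rw [one_div, Real.rpow_rpow_inv (norm_nonneg _) hr0.ne']
  | succ n ih =>
    have hfact : Fact (1 ≤ ENNReal.ofReal r) := ⟨by simpa using ENNReal.ofReal_le_ofReal hr⟩
    have htr : (ENNReal.ofReal r).toReal = r := ENNReal.toReal_ofReal hr0.le
    have hnorm : ∀ f : PiLp (ENNReal.ofReal r) fun _ : Fin (m 0) => V,
        ‖f‖ = (∑ i, ‖f i‖ ^ r) ^ (1 / r) := fun f => by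
      rw [PiLp.norm_eq_sum (by rw [htr]; exact hr0), htr]
    have h1 := ih (fun k => m k.succ) (fun k => N k.succ) (fun k => Θ k.succ)
      (fun k => hΘ k.succ) (PiLp (ENNReal.ofReal r) fun _ : Fin (m 0) => V)
      fun j => WithLp.toLp _ fun i => a (Fin.cons i j)
    have hL : ∑ j : (∀ k : Fin n, Fin (m k.succ)),
        ‖WithLp.toLp (ENNReal.ofReal r) fun i => a (Fin.cons i j)‖ ^ r = ∑ j, ‖a j‖ ^ r := by
      rw [← (Fin.consEquiv fun k => Fin (m k)).sum_comp, Fintype.sum_prod_type, Finset.sum_comm]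
      refine Finset.sum_congr rfl fun j _ => ?_
      rw [hnorm, one_div, Real.rpow_inv_rpow
        (Finset.sum_nonneg fun _ _ => by positivity) hr0.ne']
      rfl
    rw [hL] at h1
    refine h1.trans ?_
    rw [pow_succ, mul_assoc]
    refine mul_le_mul_of_nonneg_left ?_ (by positivity)
    rw [← (Fin.consEquiv fun k => Fin (N k)).sum_comp, Fintype.sum_prod_type, Finset.sum_comm,
      Finset.mul_sum]
    refine Finset.sum_le_sum fun ω _ => ?_
    rw [hnorm]
    refine (hΘ 0 V _).trans (le_of_eq ?_)
    congr 1
    refine Finset.sum_congr rfl fun ω₀ _ => ?_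
    congr 1
    rw [← (Fin.consEquiv fun k => Fin (m k)).sum_comp, Fintype.sum_prod_type]
    refine Finset.sum_congr rfl fun i _ => ?_
    simp [Fin.consEquiv, Fin.prod_univ_succ, Finset.smul_sum, smul_smul]

theorem multipleSumming_one_subset {𝕜 : Type*} [RCLike 𝕜] {n : ℕ} {E : Fin n → Type*}
    [∀ k, NormedAddCommGroup (E k)] [∀ k, NormedSpace 𝕜 (E k)]
    {F : Type u} [NormedAddCommGroup F] [NormedSpace 𝕜 F] {r : ℝ} (hr1 : 1 ≤ r) (hr2 : r < 2) :
    multipleSumming 𝕜 E F 1 ⊆ multipleSumming 𝕜 E F r := by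
  rcases hr1.eq_or_lt with rfl | hr1'
  · exact subset_rfl
  rintro A ⟨C, hC0, hC⟩
  obtain ⟨D, hD0, hD⟩ := exists_randomization.{u} 𝕜 hr1' hr2
  refine ⟨D ^ n * (C * D ^ n), by positivity, fun m x => ?_⟩
  choose N Θ hup hlow using fun k => hD (m k)
  let z : ∀ k, Fin (N k) → E k := fun k ω => ∑ j, Θ k ω j • x k j
  have hz : ∀ k, weakNorm 𝕜 1 (z k) ≤ D * weakNorm 𝕜 r (x k) := by
    intro k
    refine weakNorm_le (mul_nonneg hD0 (weakNorm_nonneg _ _)) _ fun φ hφ => ?_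
    simp only [Real.rpow_one, div_one, z, map_sum, map_smul, smul_eq_mul]
    exact (hup k fun j => φ (x k j)).trans
      (mul_le_mul_of_nonneg_left (le_weakNorm hr1 _ φ hφ) hD0)
  have hA : ∀ ω : (∀ k, Fin (N k)), A (fun k => z k (ω k)) =
      ∑ j : (∀ k, Fin (m k)), (∏ k, Θ k (ω k) (j k)) • A fun k => x k (j k) := fun ω => by
    simp only [z]
    rw [A.map_sum]
    exact Finset.sum_congr rfl fun j _ => A.map_smul_univ _ _
  have h1 := hC N z
  simp only [Real.rpow_one, div_one, hA] at h1
  refine (rpow_sum_le_sum_randomized hr1 hD0 m N Θ hlow F _).trans ?_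
  rw [mul_assoc, mul_assoc]
  refine mul_le_mul_of_nonneg_left (h1.trans ?_) (by positivity)
  refine mul_le_mul_of_nonneg_left ?_ hC0
  calc _ ≤ ∏ k, (D * weakNorm 𝕜 r (x k)) :=
        Finset.prod_le_prod (fun k _ => weakNorm_nonneg _ _) fun k _ => hz k
    _ = _ := by simp [Finset.prod_mul_distrib]

end Inclusion

end MultipleSumming

theorem mainTheorem3 {𝕜 : Type*} [RCLike 𝕜] {n : ℕ} (hn : 1 ≤ n) (E : Fin n → Type*)
    [∀ k, NormedAddCommGroup (E k)] [∀ k, NormedSpace 𝕜 (E k)] [∀ k, CompleteSpace (E k)]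
    (F : Type*) [NormedAddCommGroup F] [NormedSpace 𝕜 F] [CompleteSpace F]
    (hE : ∀ k, MultipleSumming.HasCotype 2 (E k)) :
    (∀ p : ℝ, 1 ≤ p → p ≤ 2 →
      MultipleSumming.multipleSumming 𝕜 E F 2 ⊆ MultipleSumming.multipleSumming 𝕜 E F p) ∧
    (∀ p r : ℝ, 1 ≤ p → p ≤ r → r < 2 →
      MultipleSumming.multipleSumming 𝕜 E F p = MultipleSumming.multipleSumming 𝕜 E F r) := by
  have hone : ∀ p : ℝ, 1 ≤ p → p < 2 →
      MultipleSumming.multipleSumming 𝕜 E F p = MultipleSumming.multipleSumming 𝕜 E F 1 :=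
    fun p hp1 hp2 => (MultipleSumming.multipleSumming_subset_one hE hp1 hp2.le).antisymm
      (MultipleSumming.multipleSumming_one_subset hp1 hp2)
  refine ⟨fun p hp1 hp2 => ?_, fun p r hp hpr hr => ?_⟩
  · rcases hp2.eq_or_lt with rfl | hp2
    · exact subset_rfl
    · rw [hone p hp1 hp2]
      -- The exponent `2` allows only the descent to `1`; the way back up requires `r < 2`.
      exact MultipleSumming.multipleSumming_subset_one hE one_le_two le_rfl
  · rw [hone p hp (hpr.trans_lt hr), hone r (hp.trans hpr) hr]
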